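/- Let $\langle R,\sim\rangle$ be the Rado graph, that is, a countable graph such that for all finite sets $K\subseteq H\subseteq R$ of vertices there is a vertex $v\in R\setminus H$ adjacent to every element of $K$ and to no element of $H\setminus K$. Let $\mathbb P(R)=\{f[R] : f\in\mathrm{Emb}(R)\}$ be the set of copies of $R$ inside $R$, where $\mathrm{Emb}(R)$ is the set of self-embeddings of $R$ (injections $f:R\to R$ such that $u\sim v\Leftrightarrow f(u)\sim f(v)$), ordered by inclusion. A subtree $T$ of ${}^{<\omega}\omega=\bigcup_{n\in\omega}{}^{n}\omega$ (a set of finite sequences closed under initial segments) is called binary if each $\varphi\in T$ has at most two immediate successors in $T$; let $\mathrm{Bt}({}^{<\omega}\omega)$ be the set of all binary subtrees of ${}^{<\omega}\omega$. Then the partial order $\langle\mathbb P(R),\subseteq\rangle$ has the 2-localization property: in each generic extension of the ground model $V$ by $\mathbb P(R)$, for every function $x:\omega\to\omega$ there is a binary subtree $T$ of ${}^{<\omega}\omega$ belonging to $V$ such that $x\upharpoonright n\in T$ for all $n\in\omega$; that is, $$1_{\mathbb P(R)}\Vdash \forall x:\check\omega\to\check\omega\ \ \exists T\in\big(\mathrm{Bt}({}^{<\omega}\omega)^V\big)\check{\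 }\ \ \forall n\in\check\omega\ \ x\upharpoonright n\in T .$$ -/

import Mathlib

universe u

/-! ### Names and the forcing relation

The ground model is the universe `Type u` (that is, `PSet.{u}`), and `P : Type u` is a pre-order in
it; `q ≤ p` means that `q` is a stronger condition than `p`. -/

namespace Forcing

/-- The class of `P`-names. The name `mk ι A c` is the set of pairs `{⟨A i, c i⟩ : i ∈ ι}`, where
the `A i` are `P`-names and the `c i` are conditions. -/
inductive PName (P : Type u) : Type (u + 1) where
  | mk (ι : Type u) (A : ι → PName P) (c : ι → P) : PName P

/-- A sentence of the forcing language, identified with the predicate `p ⊩ φ` of `p`. Such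
sentences are built below from atomic ones by the usual recursion clauses of the forcing
relation. -/
abbrev Sentence (P : Type u) : Type u := P → Prop

/-- The canonical name `x̌` of a ground model set: `x̌ = {⟨y̌, p⟩ : y ∈ x, p ∈ P}`. -/
def check (P : Type u) : PSet.{u} → PName P
  | ⟨ι, A⟩ => .mk (ι × P) (fun i => check P (A i.1)) (fun i => i.2)

/-- The name of the unordered pair of two sets. -/
def upName {P : Type u} (σ τ : PName P) : PName P :=
  .mk (ULift.{u} Bool × P) (fun i => cond i.1.down σ τ) (fun i => i.2)

/-- The name of the (Kuratowski) ordered pair of two sets. -/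
def opName {P : Type u} (σ τ : PName P) : PName P :=
  upName (upName σ σ) (upName σ τ)

variable {P : Type u} [Preorder P]

/-- `p ⊩ σ = τ`, by recursion on names: for each `⟨A i, a i⟩ ∈ σ`, densely many of the conditions
below `p` and `a i` force `A i = B j` and are below `b j` for some `⟨B j, b j⟩ ∈ τ`, and
vice versa. -/
def eq : PName P → PName P → Sentence P
  | .mk _ A a, .mk _ B b => fun p =>
    (∀ i, ∀ q ≤ p, q ≤ a i → ∃ r ≤ q, ∃ j, r ≤ b j ∧ eq (A i) (B j) r) ∧
    (∀ j, ∀ q ≤ p, q ≤ b j → ∃ r ≤ q, ∃ i, r ≤ a i ∧ eq (A i) (B j) r)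

/-- `p ⊩ σ ∈ τ`: the set of `q` such that `q ≤ b j` and `q ⊩ σ = B j` for some
`⟨B j, b j⟩ ∈ τ` is dense below `p`. -/
def mem (σ : PName P) : PName P → Sentence P
  | .mk κ B b => fun p => ∀ q ≤ p, ∃ r ≤ q, ∃ j : κ, r ≤ b j ∧ eq σ (B j) r

/-- `p ⊩ φ ∧ ψ`. -/
def and (φ ψ : Sentence P) : Sentence P := fun p => φ p ∧ ψ p

/-- `p ⊩ φ → ψ`: every stronger condition that forces `φ` forces `ψ`. -/
def imp (φ ψ : Sentence P) : Sentence P := fun p => ∀ q ≤ p, φ q → ψ q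

/-- `p ⊩ φ ↔ ψ`. -/
def iff (φ ψ : Sentence P) : Sentence P := and (imp φ ψ) (imp ψ φ)

/-- `p ⊩ ∀ x, φ x`. -/
def all (φ : PName P → Sentence P) : Sentence P := fun p => ∀ x, φ x p

/-- `p ⊩ ∃ x, φ x`: densely many conditions below `p` force `φ x` for some name `x`. -/
def ex (φ : PName P → Sentence P) : Sentence P := fun p => ∀ q ≤ p, ∃ r ≤ q, ∃ x, φ x r

/-- `p ⊩ ∀ x ∈ σ, φ x`. -/
def allIn (σ : PName P) (φ : PName P → Sentence P) : Sentence P := all fun x => imp (mem x σ) (φ x)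

/-- `p ⊩ ∃ x ∈ σ, φ x`. -/
def exIn (σ : PName P) (φ : PName P → Sentence P) : Sentence P := ex fun x => and (mem x σ) (φ x)

/-- The sentence `f : X → Y`: every element of `f` is a pair from `X × Y`, and for each `a ∈ X`
there is exactly one `b ∈ Y` with `⟨a, b⟩ ∈ f`. -/
def isFun (f X Y : PName P) : Sentence P :=
  and
    (allIn f fun z => exIn X fun a => exIn Y fun b => eq z (opName a b))
    (allIn X fun a => exIn Y fun b =>
      and (mem (opName a b) f) (allIn Y fun b' => imp (mem (opName a b') f) (eq b' b)))

/-- The sentence `s = f ↾ n`: the elements of `s` are exactly the elements of `f` which are of the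
form `⟨k, y⟩` with `k ∈ n`. -/
def isRestrict (s f n : PName P) : Sentence P :=
  all fun z => iff (mem z s) (and (mem z f) (exIn n fun k => ex fun y => eq z (opName k y)))

end Forcing

/-! ### Ground model objects as sets -/

namespace Ground

/-- The unordered pair `{a, b}`. -/
def upair (a b : PSet.{u}) : PSet.{u} := ⟨ULift.{u} Bool, fun i => cond i.down a b⟩

/-- The (Kuratowski) ordered pair `⟨a, b⟩ = {{a}, {a, b}}`. -/
def opair (a b : PSet.{u}) : PSet.{u} := upair (upair a a) (upair a b)

/-- A finite sequence of natural numbers as a set, namely the function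
`{⟨i, s i⟩ : i < length s}` on the von Neumann numeral `length s`. -/
def seqSet (s : List ℕ) : PSet.{u} :=
  ⟨ULift.{u} (Fin s.length),
    fun i => opair (PSet.ofNat (i.down : ℕ)) (PSet.ofNat (s.get i.down))⟩

/-- A set of finite sequences of natural numbers as a set. -/
def treeSet (T : Set (List ℕ)) : PSet.{u} := ⟨ULift.{u} T, fun s => seqSet s.down.1⟩

/-- A subtree `T` of `ω^{<ω}` (a set of finite sequences closed under initial segments) is binary
if each `s ∈ T` has at most two immediate successors in `T`. -/
def IsBinary (T : Descriptive.tree ℕ) : Prop :=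
  ∀ s ∈ T, {t : List ℕ | t ∈ T ∧ ∃ m : ℕ, t = s ++ [m]}.encard ≤ 2

/-- The set `Bt(ω^{<ω})` of all binary subtrees of `ω^{<ω}`. -/
def binaryTrees : PSet.{u} :=
  ⟨ULift.{u} {T : Descriptive.tree ℕ // IsBinary T}, fun T => treeSet (T.down.1 : Set (List ℕ))⟩

end Ground

open Forcing in
/-- The 2-localization property of a pre-order `P`: every condition forces that for each
`x : ω → ω` there is a binary subtree `T` of `ω^{<ω}` in the ground model such that `x ↾ n ∈ T` for
all `n ∈ ω`. (All conditions force a sentence iff the largest one does, if it exists.) -/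
def TwoLocalization (P : Type u) [Preorder P] : Prop :=
  ∀ p : P,
    (all fun x => imp (isFun x (check P PSet.omega) (check P PSet.omega))
      (exIn (check P Ground.binaryTrees) fun T =>
        allIn (check P PSet.omega) fun n =>
          exIn T fun s => isRestrict s x n)) p

/-! ### The Rado graph and its copies -/

/-- A graph is (isomorphic to) the Rado graph if it is countable and for all finite sets
`K ⊆ H` of vertices there is a vertex outside `H` which is adjacent to all elements of `K` and to no
element of `H \ K`. -/
def IsRadoGraph {V : Type u} (R : SimpleGraph V) : Prop :=
  Countable V ∧ ∀ H K : Finset V, K ⊆ H →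
    ∃ v, v ∉ H ∧ (∀ k ∈ K, R.Adj v k) ∧ ∀ h ∈ H, h ∉ K → ¬ R.Adj v h

/-- The set `{f[G] : f ∈ Emb(G)}` of copies of a graph inside itself, as a type. Its order, inherited
from `Set V`, is inclusion. -/
abbrev Copies {V : Type u} (G : SimpleGraph V) : Type u :=
  {S : Set V // ∃ f : G ↪g G, Set.range f = S}

/-! ### Forced equality and membership, canonical names, names of reals -/

namespace Forcing

/-! The proof is a fusion. Below a copy forcing `x` to be a function, deciding an initial segment of
`x` becomes a relation on self-embeddings (`IsDecision`). A fusion stage is a finite family of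
embeddings indexed by 0-1 sequences: bit `n` says whether the embedding passes, after stage `n`,
into the neighbourhood or the non-neighbourhood of a fixed vertex `v`
(`IsRadoGraph.exists_parallel`). All members stay parallel, so a new copy of the graph arises by
taking, at stage `n`, the image of `v` under the embedding whose bits record the adjacencies of the
`n`-th vertex.

The number of embeddings may double at each stage, so the branching of the decided values has to be
controlled. After each step all embeddings are restricted along one common embedding, so that any
two of them either decide differently already or can never be separated by a common restriction
(`IsDecision.exists_uniform`). Embeddings with equal values at stage `n` that also share bit `n`
therefore agree at stage `n + 1`. Each value thus has at most two extensions there, and the tree of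
values is binary.

Up to finitely many vertices the new copy is covered by the ranges of the embeddings of stage `n`.
By indivisibility (`IsRadoGraph.exists_embedding_of_diff_finite`) every smaller copy contains a copy
inside one of these ranges, which decides `x` up to `n` to lie in the tree. -/

theorem check_upair (P : Type u) (x y : PSet.{u}) :
    check P (Ground.upair x y) = upName (check P x) (check P y) := by
  rw [Ground.upair, check, upName]
  congr 1
  funext i
  cases i.1.down <;> rfl

theorem check_opair (P : Type u) (x y : PSet.{u}) :
    check P (Ground.opair x y) = opName (check P x) (check P y) := by
  rw [Ground.opair, check_upair, check_upair, check_upair, opName]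

variable {P : Type u} [Preorder P]

theorem eq_mk {ι κ : Type u} {A : ι → PName P} {a : ι → P} {B : κ → PName P} {b : κ → P} {p : P} :
    eq (.mk ι A a) (.mk κ B b) p ↔
      (∀ i, ∀ q ≤ p, q ≤ a i → ∃ r ≤ q, ∃ j, r ≤ b j ∧ eq (A i) (B j) r) ∧
      (∀ j, ∀ q ≤ p, q ≤ b j → ∃ r ≤ q, ∃ i, r ≤ a i ∧ eq (A i) (B j) r) := by
  rw [eq]

theorem mem_mk {κ : Type u} {σ : PName P} {B : κ → PName P} {b : κ → P} {p : P} :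
    mem σ (.mk κ B b) p ↔ ∀ q ≤ p, ∃ r ≤ q, ∃ j : κ, r ≤ b j ∧ eq σ (B j) r := by
  rw [mem]

theorem eq_mono {σ τ : PName P} {p q : P} (hq : q ≤ p) (h : eq σ τ p) : eq σ τ q := by
  obtain ⟨ι, A, a⟩ := σ
  obtain ⟨κ, B, b⟩ := τ
  rw [eq_mk] at h ⊢
  exact ⟨fun i r hr => h.1 i r (hr.trans hq), fun j r hr => h.2 j r (hr.trans hq)⟩

theorem mem_mono {σ τ : PName P} {p q : P} (hq : q ≤ p) (h : mem σ τ p) : mem σ τ q := by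
  obtain ⟨κ, B, b⟩ := τ
  rw [mem_mk] at h ⊢
  exact fun r hr => h r (hr.trans hq)

theorem eq_refl (σ : PName P) (p : P) : eq σ σ p := by
  induction σ generalizing p with
  | mk ι A a ih =>
    rw [eq_mk]
    exact ⟨fun i q _ hi => ⟨q, le_rfl, i, hi, ih i q⟩, fun i q _ hi => ⟨q, le_rfl, i, hi, ih i q⟩⟩

theorem eq_symm {σ τ : PName P} {p : P} (h : eq σ τ p) : eq τ σ p := by
  induction σ generalizing τ p with
  | mk ι A a ih =>
    obtain ⟨κ, B, b⟩ := τ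
    rw [eq_mk] at h ⊢
    refine ⟨fun j q hq hj => ?_, fun i q hq hi => ?_⟩
    · obtain ⟨r, hr, i, hi, e⟩ := h.2 j q hq hj
      exact ⟨r, hr, i, hi, ih i e⟩
    · obtain ⟨r, hr, j, hj, e⟩ := h.1 i q hq hi
      exact ⟨r, hr, j, hj, ih i e⟩

theorem eq_trans {σ τ ρ : PName P} {p : P} (h : eq σ τ p) (h' : eq τ ρ p) : eq σ ρ p := by
  induction σ generalizing τ ρ p with
  | mk ι A a ih =>
    obtain ⟨κ, B, b⟩ := τ
    obtain ⟨l, C, c⟩ := ρ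
    rw [eq_mk] at h h' ⊢
    refine ⟨fun i q hq hi => ?_, fun k q hq hk => ?_⟩
    · obtain ⟨r, hr, j, hj, e⟩ := h.1 i q hq hi
      obtain ⟨s, hs, k, hk, e'⟩ := h'.1 j r (hr.trans hq) hj
      exact ⟨s, hs.trans hr, k, hk, ih i (eq_mono hs e) e'⟩
    · obtain ⟨r, hr, j, hj, e⟩ := h'.2 k q hq hk
      obtain ⟨s, hs, i, hi, e'⟩ := h.2 j r (hr.trans hq) hj
      exact ⟨s, hs.trans hr, i, hi, ih i e' (eq_mono hs e)⟩

theorem eq_of_dense {σ τ : PName P} {p : P} (h : ∀ q ≤ p, ∃ r ≤ q, eq σ τ r) : eq σ τ p := by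
  obtain ⟨ι, A, a⟩ := σ
  obtain ⟨κ, B, b⟩ := τ
  rw [eq_mk]
  refine ⟨fun i q hq hi => ?_, fun j q hq hj => ?_⟩
  · obtain ⟨r, hr, e⟩ := h q hq
    obtain ⟨s, hs, j, e'⟩ := (eq_mk.1 e).1 i r le_rfl (hr.trans hi)
    exact ⟨s, hs.trans hr, j, e'⟩
  · obtain ⟨r, hr, e⟩ := h q hq
    obtain ⟨s, hs, j, e'⟩ := (eq_mk.1 e).2 j r le_rfl (hr.trans hj)
    exact ⟨s, hs.trans hr, j, e'⟩

theorem mem_of_dense {σ τ : PName P} {p : P} (h : ∀ q ≤ p, ∃ r ≤ q, mem σ τ r) : mem σ τ p := by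
  obtain ⟨κ, B, b⟩ := τ
  rw [mem_mk]
  intro q hq
  obtain ⟨r, hr, e⟩ := h q hq
  obtain ⟨s, hs, e'⟩ := mem_mk.1 e r le_rfl
  exact ⟨s, hs.trans hr, e'⟩

theorem mem_congr_left {σ σ' τ : PName P} {p : P} (h : eq σ σ' p) (hm : mem σ τ p) :
    mem σ' τ p := by
  obtain ⟨κ, B, b⟩ := τ
  rw [mem_mk] at hm ⊢
  intro q hq
  obtain ⟨r, hr, j, hj, e⟩ := hm q hq
  exact ⟨r, hr, j, hj, eq_trans (eq_symm (eq_mono (hr.trans hq) h)) e⟩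

theorem mem_congr_right {σ τ τ' : PName P} {p : P} (h : eq τ τ' p) (hm : mem σ τ p) :
    mem σ τ' p := by
  obtain ⟨κ, B, b⟩ := τ
  obtain ⟨l, C, c⟩ := τ'
  rw [mem_mk] at hm ⊢
  rw [eq_mk] at h
  intro q hq
  obtain ⟨r, hr, j, hj, e⟩ := hm q hq
  obtain ⟨s, hs, k, hk, e'⟩ := h.1 j r (hr.trans hq) hj
  exact ⟨s, hs.trans hr, k, hk, eq_trans (eq_mono hs e) e'⟩

theorem eq_of_forall_mem_iff {σ τ : PName P} {p : P}
    (h : ∀ q ≤ p, ∀ z, mem z σ q ↔ mem z τ q) : eq σ τ p := by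
  obtain ⟨ι, A, a⟩ := σ
  obtain ⟨κ, B, b⟩ := τ
  rw [eq_mk]
  refine ⟨fun i q hq hi => ?_, fun j q hq hj => ?_⟩
  · have := (h q hq (A i)).1 (mem_mk.2 fun r hr => ⟨r, le_rfl, i, hr.trans hi, eq_refl _ _⟩)
    exact mem_mk.1 this q le_rfl
  · have := (h q hq (B j)).2 (mem_mk.2 fun r hr => ⟨r, le_rfl, j, hr.trans hj, eq_refl _ _⟩)
    obtain ⟨r, hr, i, hi, e⟩ := mem_mk.1 this q le_rfl
    exact ⟨r, hr, i, hi, eq_symm e⟩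

/-! #### Pairs -/

theorem mem_upName {z σ τ : PName P} {p : P} :
    mem z (upName σ τ) p ↔ ∀ q ≤ p, ∃ r ≤ q, eq z σ r ∨ eq z τ r := by
  rw [upName, mem_mk]
  refine forall₂_congr fun q _ => exists_congr fun r => and_congr_right fun _ => ⟨?_, ?_⟩
  · rintro ⟨⟨⟨_ | _⟩, s⟩, _, e⟩
    exacts [.inr e, .inl e]
  · rintro (e | e)
    exacts [⟨⟨⟨true⟩, r⟩, le_rfl, e⟩, ⟨⟨⟨false⟩, r⟩, le_rfl, e⟩]

theorem mem_upName_left (σ τ : PName P) (p : P) : mem σ (upName σ τ) p :=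
  mem_upName.2 fun q _ => ⟨q, le_rfl, .inl (eq_refl _ _)⟩

theorem mem_upName_right (σ τ : PName P) (p : P) : mem τ (upName σ τ) p :=
  mem_upName.2 fun q _ => ⟨q, le_rfl, .inr (eq_refl _ _)⟩

theorem upName_congr {σ σ' τ τ' : PName P} {p : P} (h : eq σ σ' p) (h' : eq τ τ' p) :
    eq (upName σ τ) (upName σ' τ') p := by
  refine eq_of_forall_mem_iff fun q hq z => ?_
  rw [mem_upName, mem_upName]
  refine forall₂_congr fun r hr => exists_congr fun s => and_congr_right fun hs => ?_
  have hsp := hs.trans (hr.trans hq)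
  exact or_congr
    ⟨fun e => eq_trans e (eq_mono hsp h), fun e => eq_trans e (eq_symm (eq_mono hsp h))⟩
    ⟨fun e => eq_trans e (eq_mono hsp h'), fun e => eq_trans e (eq_symm (eq_mono hsp h'))⟩

theorem opName_congr {σ σ' τ τ' : PName P} {p : P} (h : eq σ σ' p) (h' : eq τ τ' p) :
    eq (opName σ τ) (opName σ' τ') p :=
  upName_congr (upName_congr h h) (upName_congr h h')

theorem eq_of_mem_singleton {z σ : PName P} {p : P} (h : mem z (upName σ σ) p) : eq z σ p :=
  eq_of_dense fun q hq => by simpa using mem_upName.1 h q hq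

/-- Densely often `τ` equals `τ'` or `σ`. In the latter case the pair collapses to the singleton of
`τ`, and `τ'` is a member of it. -/
theorem upName_right_injective {σ τ τ' : PName P} {p : P}
    (h : eq (upName σ τ) (upName σ τ') p) : eq τ τ' p := by
  refine eq_of_dense fun q hq => ?_
  obtain ⟨r, hr, e | e⟩ := mem_upName.1 (mem_congr_right h (mem_upName_right σ τ p)) q hq
  · refine ⟨r, hr, ?_⟩
    have h1 := mem_congr_right (eq_symm (eq_mono (hr.trans hq) h)) (mem_upName_right σ τ' r)
    have h2 := mem_congr_right (upName_congr (eq_symm e) (eq_refl τ r)) h1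
    exact eq_symm (eq_of_mem_singleton h2)
  · exact ⟨r, hr, e⟩

/-- Whichever member of the right-hand pair `{σ}` equals, `σ'` belongs to it. Once the first
coordinates agree, right cancellation applies to the outer and then to the inner pair. -/
theorem opName_injective {σ σ' τ τ' : PName P} {p : P}
    (h : eq (opName σ τ) (opName σ' τ') p) : eq σ σ' p ∧ eq τ τ' p := by
  have h1 : eq σ σ' p := by
    refine eq_of_dense fun q hq => ?_
    obtain ⟨r, hr, e⟩ := mem_upName.1 (mem_congr_right h (mem_upName_left _ _ p)) q hq
    refine ⟨r, hr, eq_symm (eq_of_mem_singleton ?_)⟩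
    rcases e with e | e
    exacts [mem_congr_right (eq_symm e) (mem_upName_left _ _ _),
      mem_congr_right (eq_symm e) (mem_upName_left _ _ _)]
  refine ⟨h1, ?_⟩
  have h2 : eq (opName σ τ) (opName σ τ') p :=
    eq_trans h (opName_congr (eq_symm h1) (eq_refl _ _))
  exact upName_right_injective (upName_right_injective h2)

/-! #### Canonical names -/

theorem mem_check {z : PName P} {x : PSet.{u}} {p : P} :
    mem z (check P x) p ↔ ∀ q ≤ p, ∃ r ≤ q, ∃ i : x.Type, eq z (check P (x.Func i)) r := by
  obtain ⟨ι, A⟩ := x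
  rw [check, mem_mk]
  refine forall₂_congr fun q _ => exists_congr fun r => and_congr_right fun _ => ⟨?_, ?_⟩
  · rintro ⟨⟨i, s⟩, _, e⟩
    exact ⟨i, e⟩
  · rintro ⟨i, e⟩
    exact ⟨⟨i, r⟩, le_rfl, e⟩

theorem check_func_mem (x : PSet.{u}) (i : x.Type) (p : P) :
    mem (check P (x.Func i)) (check P x) p :=
  mem_check.2 fun q _ => ⟨q, le_rfl, i, eq_refl _ _⟩

theorem check_eq_of_equiv {x y : PSet.{u}} (h : x.Equiv y) (p : P) :
    eq (check P x) (check P y) p := by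
  induction x generalizing y p with
  | mk ι A ih =>
    obtain ⟨κ, B⟩ := y
    rw [check, check, eq_mk]
    refine ⟨?_, ?_⟩
    · rintro ⟨i, _⟩ q _ _
      obtain ⟨j, e⟩ := h.1 i
      exact ⟨q, le_rfl, ⟨j, q⟩, le_rfl, ih i e q⟩
    · rintro ⟨j, _⟩ q _ _
      obtain ⟨i, e⟩ := h.2 j
      exact ⟨q, le_rfl, ⟨i, q⟩, le_rfl, ih i e q⟩

/-- Canonical names attach every condition to every member, so `p` itself can be used as the
attached condition and a single condition settles the equality. -/
theorem equiv_of_check_eq {x y : PSet.{u}} {p : P} (h : eq (check P x) (check P y) p) :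
    x.Equiv y := by
  induction x generalizing y p with
  | mk ι A ih =>
    obtain ⟨κ, B⟩ := y
    rw [check, check, eq_mk] at h
    refine ⟨fun i => ?_, fun j => ?_⟩
    · obtain ⟨r, _, j, _, e⟩ := h.1 (i, p) p le_rfl le_rfl
      exact ⟨j.1, ih i e⟩
    · obtain ⟨r, _, i, _, e⟩ := h.2 (j, p) p le_rfl le_rfl
      exact ⟨i.1, ih i.1 e⟩

theorem check_mem_of_mem {x y : PSet.{u}} (h : x ∈ y) (p : P) : mem (check P x) (check P y) p := by
  obtain ⟨i, e⟩ := h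
  exact mem_congr_left (check_eq_of_equiv e.symm p) (check_func_mem y i p)

theorem mem_ofNat {n : ℕ} {x : PSet.{u}} :
    x ∈ PSet.ofNat.{u} n ↔ ∃ i < n, x.Equiv (PSet.ofNat.{u} i) := by
  induction n with
  | zero => simp [PSet.ofNat]
  | succ n ih =>
    rw [PSet.ofNat, PSet.mem_insert_iff, ih]
    constructor
    · rintro (h | ⟨i, hi, h⟩)
      exacts [⟨n, by omega, h⟩, ⟨i, by omega, h⟩]
    · rintro ⟨i, hi, h⟩
      rcases (Nat.lt_succ_iff_lt_or_eq.1 hi) with hi | rfl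
      exacts [.inr ⟨i, hi, h⟩, .inl h]

theorem ofNat_equiv_iff {m n : ℕ} : (PSet.ofNat.{u} m).Equiv (PSet.ofNat.{u} n) ↔ m = n := by
  refine ⟨fun h => ?_, fun h => h ▸ PSet.Equiv.refl _⟩
  have key : ∀ {a b : ℕ}, a < b → ¬ (PSet.ofNat.{u} a).Equiv (PSet.ofNat.{u} b) :=
      fun {a b} hab e =>
    PSet.mem_irrefl _ ((PSet.Mem.congr_right e).2 (mem_ofNat.2 ⟨a, hab, PSet.Equiv.refl _⟩))
  rcases lt_trichotomy m n with hlt | heq | hgt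
  exacts [(key hlt h).elim, heq, (key hgt h.symm).elim]

theorem mem_check_ofNat {z : PName P} {n : ℕ} {p : P} (h : mem z (check P (PSet.ofNat n)) p) :
    ∀ q ≤ p, ∃ r ≤ q, ∃ i < n, eq z (check P (PSet.ofNat i)) r := by
  intro q hq
  obtain ⟨r, hr, i, e⟩ := mem_check.1 h q hq
  obtain ⟨k, hk, e'⟩ := mem_ofNat.1 (PSet.func_mem _ i)
  exact ⟨r, hr, k, hk, eq_trans e (check_eq_of_equiv e' r)⟩

theorem mem_check_omega {z : PName P} {p : P} (h : mem z (check P PSet.omega) p) :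
    ∀ q ≤ p, ∃ r ≤ q, ∃ i : ℕ, eq z (check P (PSet.ofNat i)) r := by
  intro q hq
  obtain ⟨r, hr, i, e⟩ := mem_check.1 h q hq
  exact ⟨r, hr, i.down, e⟩

theorem check_ofNat_mem_omega (n : ℕ) (p : P) :
    mem (check P (PSet.ofNat n)) (check P PSet.omega) p :=
  check_func_mem PSet.omega ⟨n⟩ p

/-! #### Names of functions from `ω` to `ω` -/

/-- The name of the pair `⟨m, n⟩` of natural numbers. -/
def natPair (P : Type u) (m n : ℕ) : PName P :=
  opName (check P (PSet.ofNat m)) (check P (PSet.ofNat n))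

/-- `p` forces that `s` is an initial segment of the function named by `x`. -/
def Decides (x : PName P) (p : P) (s : List ℕ) : Prop :=
  ∀ i, ∀ hi : i < s.length, mem (natPair P i s[i]) x p

theorem Decides.mono {x : PName P} {p q : P} {s : List ℕ} (h : Decides x p s) (hq : q ≤ p) :
    Decides x q s :=
  fun i hi => mem_mono hq (h i hi)

theorem Decides.of_prefix {x : PName P} {p : P} {s t : List ℕ} (h : Decides x p t)
    (hs : s <+: t) : Decides x p s := fun i hi => by
  have := h i (hi.trans_le hs.length_le)
  rwa [← hs.getElem hi] at this

/-- `p` forces that `x` is a function from `ω` to `ω`. -/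
abbrev IsReal (x : PName P) (p : P) : Prop :=
  isFun x (check P PSet.omega) (check P PSet.omega) p

theorem IsReal.eq_of_mem {x : PName P} {p : P} (hx : IsReal x p) {q : P} (hq : q ≤ p)
    {k m n : ℕ} (hm : mem (natPair P k m) x q) (hn : mem (natPair P k n) x q) : m = n := by
  obtain ⟨r, hr, b, _, _, h⟩ := hx.2 _ p le_rfl (check_ofNat_mem_omega k p) q hq
  have em := h _ r le_rfl (check_ofNat_mem_omega m r) r le_rfl (mem_mono hr hm)
  have en := h _ r le_rfl (check_ofNat_mem_omega n r) r le_rfl (mem_mono hr hn)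
  exact ofNat_equiv_iff.1 (equiv_of_check_eq (eq_trans em (eq_symm en)))

theorem IsReal.exists_mem {x : PName P} {p : P} (hx : IsReal x p) {q : P} (hq : q ≤ p) (k : ℕ) :
    ∃ r ≤ q, ∃ n, mem (natPair P k n) x r := by
  obtain ⟨r, hr, b, hb, hk, _⟩ := hx.2 _ p le_rfl (check_ofNat_mem_omega k p) q hq
  obtain ⟨s, hs, n, e⟩ := mem_check_omega hb r le_rfl
  exact ⟨s, hs.trans hr, n, mem_congr_left (opName_congr (eq_refl _ _) e) (mem_mono hs hk)⟩

theorem IsReal.decides_unique {x : PName P} {p : P} (hx : IsReal x p) {q : P} (hq : q ≤ p)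
    {s t : List ℕ} (hs : Decides x q s) (ht : Decides x q t) (hl : s.length = t.length) : s = t :=
  List.ext_getElem hl fun i h₁ h₂ => hx.eq_of_mem hq (hs i h₁) (ht i h₂)

theorem IsReal.exists_decides {x : PName P} {p : P} (hx : IsReal x p) {q : P} (hq : q ≤ p)
    (n : ℕ) : ∃ r ≤ q, ∃ s : List ℕ, s.length = n ∧ Decides x r s := by
  induction n with
  | zero => exact ⟨q, le_rfl, [], rfl, fun i hi => absurd hi (by simp)⟩
  | succ n ih =>
    obtain ⟨r, hr, s, rfl, h⟩ := ih
    obtain ⟨r', hr', m, hm⟩ := hx.exists_mem (hr.trans hq) s.length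
    refine ⟨r', hr'.trans hr, s ++ [m], by simp, fun i hi => ?_⟩
    rw [List.getElem_append]
    split_ifs with hlt
    · exact h.mono hr' i hlt
    · obtain rfl : i = s.length := by simp at hi; omega
      simpa using hm

/-- The delicate inclusion starts from a forced member `⟨k, y⟩` of `x` with `k ∈ n`, where `y` is an
arbitrary name. That `x` is a function makes `y` densely a numeral, and uniqueness of values
identifies it with the entry of `s`. -/
theorem IsReal.isRestrict_of_decides {x : PName P} {p : P} (hx : IsReal x p) {q : P} (hq : q ≤ p)
    {s : List ℕ} (hs : Decides x q s) {n : PName P}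
    (hn : eq n (check P (PSet.ofNat s.length)) q) :
    isRestrict (check P (Ground.seqSet s)) x n q := by
  intro z
  refine ⟨fun r hr hz => ⟨?_, ?_⟩, fun r hr hz => ?_⟩
  · refine mem_of_dense fun r' hr' => ?_
    obtain ⟨t, ht, i, e⟩ := mem_check.1 hz r' hr'
    refine ⟨t, ht, mem_congr_left (eq_symm e) ?_⟩
    change mem (check P (Ground.opair _ _)) x t
    rw [check_opair]
    exact mem_mono (ht.trans (hr'.trans hr)) (hs i.down i.down.2)
  · intro r' hr'
    obtain ⟨t, ht, i, e⟩ := mem_check.1 hz r' hr'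
    replace e : eq z (check P (Ground.opair _ _)) t := e
    rw [check_opair] at e
    refine ⟨t, ht, _, ?_, fun t' ht' => ⟨t', le_rfl, _, eq_mono ht' e⟩⟩
    exact mem_congr_right (eq_symm (eq_mono (ht.trans (hr'.trans hr)) hn))
      (check_mem_of_mem (mem_ofNat.2 ⟨_, i.down.2, PSet.Equiv.refl _⟩) t)
  · refine mem_of_dense fun r' hr' => ?_
    obtain ⟨hzx, hzn⟩ := hz
    obtain ⟨r₁, h₁, k, hk, hy⟩ := hzn r' hr'
    obtain ⟨r₂, h₂, y, hzy⟩ := hy r₁ le_rfl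
    have h₂r := h₂.trans (h₁.trans hr')
    have h₂q := h₂r.trans hr
    obtain ⟨r₃, h₃, i, hi, ek⟩ := mem_check_ofNat
      (mem_congr_right (eq_mono h₂q hn) (mem_mono h₂ hk)) r₂ le_rfl
    obtain ⟨r₄, h₄, a, ha, hab⟩ := hx.1 z r₂ (h₂q.trans hq) (mem_mono h₂r hzx) r₃ h₃
    obtain ⟨r₅, h₅, b, hb, hzab⟩ := hab r₄ le_rfl
    obtain ⟨r₆, h₆, m, em⟩ := mem_check_omega hb r₅ le_rfl
    have h₆₃ := h₆.trans (h₅.trans h₄)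
    have h₆₂ := h₆₃.trans h₃
    have hab' := opName_injective (eq_trans (eq_symm (eq_mono h₆₂ hzy)) (eq_mono h₆ hzab))
    have ez : eq z (natPair P i m) r₆ := eq_trans (eq_mono h₆₂ hzy)
      (opName_congr (eq_mono h₆₃ ek) (eq_trans hab'.2 em))
    have hm : m = s[i] := hx.eq_of_mem (h₆₂.trans (h₂q.trans hq))
      (mem_congr_left ez (mem_mono (h₆₂.trans h₂r) hzx)) (mem_mono (h₆₂.trans h₂q) (hs i hi))
    subst hm
    refine ⟨r₆, h₆₂.trans (h₂.trans h₁), mem_congr_left (eq_symm ez) ?_⟩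
    rw [natPair, ← check_opair]
    exact check_func_mem (Ground.seqSet s) ⟨⟨i, hi⟩⟩ r₆

/-- If densely many conditions below `p` decide arbitrarily long initial segments of `x` to be
elements of the binary tree `T`, then `p` forces `x` to be a branch of some binary tree. -/
theorem IsReal.exIn_binaryTrees {x : PName P} {p : P} (hx : IsReal x p) (T : Descriptive.tree ℕ)
    (hT : Ground.IsBinary T)
    (h : ∀ q ≤ p, ∀ n : ℕ, ∃ r ≤ q, ∃ s ∈ T, s.length = n ∧ Decides x r s) :
    ∃ t : PName P, and (mem t (check P Ground.binaryTrees))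
      (allIn (check P PSet.omega) fun n => exIn t fun s => isRestrict s x n) p := by
  refine ⟨check P (Ground.treeSet (T : Set (List ℕ))),
    check_func_mem Ground.binaryTrees ⟨⟨T, hT⟩⟩ p, fun n q hq hn r hr => ?_⟩
  obtain ⟨r₁, h₁, k, ek⟩ := mem_check_omega hn r hr
  obtain ⟨r₂, h₂, s, hsT, rfl, hs⟩ := h r₁ (h₁.trans (hr.trans hq)) k
  exact ⟨r₂, h₂.trans h₁, _, check_func_mem (Ground.treeSet (T : Set (List ℕ))) ⟨⟨s, hsT⟩⟩ r₂,
    hx.isRestrict_of_decides (h₂.trans (h₁.trans (hr.trans hq))) hs (eq_mono h₂ ek)⟩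

end Forcing

/-! ### Recursive construction of self-embeddings -/

/-- A sequence can be built term by term when finitely many constraints can always be met. -/
theorem exists_seq_of_forall_extend {β : Type*} [Nonempty β] (p : β → Prop)
    (ρ : ℕ → ℕ → β → β → Prop)
    (h : ∀ (n : ℕ) (f : ℕ → β), (∀ i < n, p (f i)) → (∀ i j, i < j → j < n → ρ i j (f i) (f j)) →
      ∃ y, p y ∧ ∀ i < n, ρ i n (f i) y) :
    ∃ f : ℕ → β, (∀ i, p (f i)) ∧ ∀ i j, i < j → ρ i j (f i) (f j) := by
  classical
  let good (n : ℕ) (f : ℕ → β) : Prop :=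
    (∀ i < n, p (f i)) ∧ ∀ i j, i < j → j < n → ρ i j (f i) (f j)
  have step (n : ℕ) (f : ℕ → β) (hf : good n f) :
      ∃ g, good (n + 1) g ∧ ∀ i < n, g i = f i := by
    obtain ⟨y, hy, hr⟩ := h n f hf.1 hf.2
    refine ⟨Function.update f n y, ⟨fun i hi => ?_, fun i j hij hj => ?_⟩,
      fun i hi => Function.update_of_ne hi.ne _ _⟩
    · rcases Nat.lt_succ_iff_lt_or_eq.1 hi with hi | rfl
      · rw [Function.update_of_ne hi.ne]; exact hf.1 i hi
      · rwa [Function.update_self]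
    · rcases Nat.lt_succ_iff_lt_or_eq.1 hj with hj | rfl
      · rw [Function.update_of_ne hj.ne, Function.update_of_ne (hij.trans hj).ne]
        exact hf.2 i j hij hj
      · rw [Function.update_self, Function.update_of_ne hij.ne]
        exact hr i hij
  choose! g hg hgf using step
  -- Only the first `n` terms of `F n` matter. Later stages preserve them, so the limit is the
  -- diagonal `F (i + 1) i`.
  let F : ℕ → ℕ → β := fun n => Nat.rec (fun _ => Classical.arbitrary β) g n
  have hF (n : ℕ) : good n (F n) := by
    induction n with
    | zero => exact ⟨fun i hi => absurd hi (by omega), fun i j _ hj => absurd hj (by omega)⟩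
    | succ n ih => exact hg n _ ih
  have hFF (i n : ℕ) (hn : i < n) : F n i = F (i + 1) i := by
    induction n, hn using Nat.le_induction with
    | base => rfl
    | succ n hn ih => exact (hgf n _ (hF n) i hn).trans ih
  refine ⟨fun i => F (i + 1) i, fun i => (hF (i + 1)).1 i (by omega), fun i j hij => ?_⟩
  have := (hF (j + 1)).2 i j hij (by omega)
  rwa [hFF i (j + 1) (by omega)] at this

/-- A sequence of vertices which are related in the same way as the vertices of an enumeration of a
graph is a self-embedding. -/
theorem exists_embedding_of_seq {V : Type u} {R : SimpleGraph V} (r : ℕ ≃ V) (c : ℕ → V)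
    (h : ∀ m n, m < n → c m ≠ c n ∧ (R.Adj (c m) (c n) ↔ R.Adj (r m) (r n))) :
    ∃ f : R ↪g R, ∀ a, f a = c (r.symm a) := by
  have hinj : Function.Injective c := fun i j hij => by
    by_contra hne
    rcases lt_or_gt_of_ne hne with hlt | hlt
    exacts [(h _ _ hlt).1 hij, (h _ _ hlt).1 hij.symm]
  have hadj (i j : ℕ) : R.Adj (c i) (c j) ↔ R.Adj (r i) (r j) := by
    rcases lt_trichotomy i j with hlt | rfl | hlt
    · exact (h _ _ hlt).2
    · simp
    · rw [R.adj_comm, (h _ _ hlt).2, R.adj_comm]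
  refine ⟨⟨⟨c ∘ r.symm, hinj.comp r.symm.injective⟩, fun {a b} => ?_⟩, fun a => rfl⟩
  simp [hadj]

/-! ### Extension property and indivisibility -/

namespace IsRadoGraph

variable {V : Type u} {R : SimpleGraph V}

theorem infinite (hR : IsRadoGraph R) : Infinite V :=
  Infinite.of_not_fintype fun _ => by
    obtain ⟨v, hv, _⟩ := hR.2 Finset.univ ∅ (Finset.empty_subset _)
    exact hv (Finset.mem_univ v)

theorem nonempty_equiv (hR : IsRadoGraph R) : Nonempty (ℕ ≃ V) := by
  have := hR.1
  have := hR.infinite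
  exact nonempty_equiv_of_countable

/-- A set of vertices with the extension property of the Rado graph contains a copy of it. -/
theorem exists_embedding_of_extension (hR : IsRadoGraph R) {X : Set V}
    (hX : ∀ H K : Finset V, K ⊆ H → (H : Set V) ⊆ X →
      ∃ v ∈ X, v ∉ H ∧ (∀ k ∈ K, R.Adj v k) ∧ ∀ h ∈ H, h ∉ K → ¬ R.Adj v h) :
    ∃ f : R ↪g R, Set.range f ⊆ X := by
  classical
  obtain ⟨r⟩ := hR.nonempty_equiv
  have : Nonempty V := ⟨r 0⟩
  obtain ⟨f, hf, hff⟩ := exists_seq_of_forall_extend (β := V) (· ∈ X)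
    (fun i j a b => a ≠ b ∧ (R.Adj a b ↔ R.Adj (r i) (r j))) fun n f hf hff => by
      let H := (Finset.range n).image f
      let K := ((Finset.range n).filter fun i => R.Adj (r i) (r n)).image f
      obtain ⟨v, hvX, hvH, hvK, hv⟩ := hX H K (Finset.image_subset_image (Finset.filter_subset _ _))
        (by simpa [H, Set.subset_def] using hf)
      have hfH (i : ℕ) (hi : i < n) : f i ∈ H := Finset.mem_image_of_mem f (Finset.mem_range.2 hi)
      refine ⟨v, hvX, fun i hi => ⟨fun h => hvH (h ▸ hfH i hi), fun h => ?_, fun h => ?_⟩⟩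
      · by_contra hc
        refine hv _ (hfH i hi) (fun hK => ?_) h.symm
        simp only [K, Finset.mem_image, Finset.mem_filter, Finset.mem_range] at hK
        obtain ⟨j, ⟨hj, hadj⟩, hji⟩ := hK
        rcases lt_trichotomy i j with hlt | rfl | hlt
        exacts [(hff i j hlt hj).1 hji.symm, hc hadj, (hff j i hlt hi).1 hji]
      · exact (hvK _ (Finset.mem_image_of_mem f (by simp [hi, h]))).symm
  obtain ⟨g, hg⟩ := exists_embedding_of_seq r f hff
  refine ⟨g, ?_⟩
  rintro _ ⟨a, rfl⟩
  exact hg a ▸ hf _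

/-- The Rado graph is indivisible. -/
theorem exists_embedding_of_subset_union (hR : IsRadoGraph R) {X Y : Set V} {f : R ↪g R}
    (hf : Set.range f ⊆ X ∪ Y) :
    (∃ g : R ↪g R, Set.range (f.comp g) ⊆ X) ∨ ∃ g : R ↪g R, Set.range (f.comp g) ⊆ Y := by
  classical
  by_cases hX : ∀ H K : Finset V, K ⊆ H → (H : Set V) ⊆ f ⁻¹' X →
      ∃ v ∈ f ⁻¹' X, v ∉ H ∧ (∀ k ∈ K, R.Adj v k) ∧ ∀ h ∈ H, h ∉ K → ¬ R.Adj v h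
  · obtain ⟨g, hg⟩ := hR.exists_embedding_of_extension hX
    exact .inl ⟨g, by rintro _ ⟨a, rfl⟩; exact hg ⟨a, rfl⟩⟩
  · push Not at hX
    obtain ⟨H, K, hKH, hHX, hno⟩ := hX
    -- The vertices with the unrealised type `(H, K)` miss `f ⁻¹' X`. They have the extension
    -- property: they are disjoint from `H`, so a type over finitely many of them can be combined
    -- with `(H, K)`.
    obtain ⟨g, hg⟩ := hR.exists_embedding_of_extension
      (X := {v | v ∉ H ∧ (∀ k ∈ K, R.Adj v k) ∧ ∀ h ∈ H, h ∉ K → ¬ R.Adj v h})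
      fun H' K' hKH' hH' => by
        obtain ⟨v, hv, hvK, hvH⟩ := hR.2 (H ∪ H') (K ∪ K') (Finset.union_subset_union hKH hKH')
        rw [Finset.mem_union, not_or] at hv
        refine ⟨v, ⟨hv.1, fun k hk => hvK k (by simp [hk]), fun h hh hhK => ?_⟩, hv.2,
          fun k hk => hvK k (by simp [hk]), fun h hh hhK => ?_⟩
        · refine hvH h (by simp [hh]) fun hc => ?_
          rcases Finset.mem_union.1 hc with hc | hc
          exacts [hhK hc, (hH' (hKH' hc)).1 hh]
        · refine hvH h (by simp [hh]) fun hc => ?_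
          rcases Finset.mem_union.1 hc with hc | hc
          exacts [(hH' hh).1 (hKH hc), hhK hc]
    refine .inr ⟨g, ?_⟩
    rintro _ ⟨a, rfl⟩
    have ha := hg ⟨a, rfl⟩
    refine (hf ⟨g a, rfl⟩).resolve_left fun hc => ?_
    obtain ⟨h, hh, hhK, hadj⟩ := hno (g a) hc ha.1 ha.2.1
    exact ha.2.2 h hh hhK hadj

/-- If a copy is covered by a finite set and finitely many other sets, one of the latter contains a
copy below the given one. -/
theorem exists_embedding_of_diff_finite (hR : IsRadoGraph R) {ι : Type*} {I : Set ι}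
    (hI : I.Finite) (S : ι → Set V) (f : R ↪g R) (hf : (Set.range f \ ⋃ i ∈ I, S i).Finite) :
    ∃ i ∈ I, ∃ g : R ↪g R, Set.range (f.comp g) ⊆ S i := by
  induction I, hI using Set.Finite.induction_on generalizing f with
  | empty =>
    have := hR.infinite
    simp only [Set.mem_empty_iff_false, Set.iUnion_of_empty, Set.iUnion_empty, Set.sdiff_empty] at hf
    exact absurd hf (Set.infinite_range_of_injective f.injective)
  | @insert i I _ _ ih =>
    -- If the copy shrinks into the complement of `S i`, then whatever the remaining sets leave
    -- uncovered was uncovered before, so it is still finite.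
    rcases hR.exists_embedding_of_subset_union (X := S i) (Y := (S i)ᶜ) (f := f) (by simp) with
      ⟨g, hg⟩ | ⟨g, hg⟩
    · exact ⟨i, Set.mem_insert _ _, g, hg⟩
    · obtain ⟨j, hj, h, hh⟩ := ih (f.comp g) (hf.subset fun v hv => by
        refine ⟨?_, ?_⟩
        · obtain ⟨a, rfl⟩ := hv.1
          exact ⟨g a, rfl⟩
        · rw [Set.biUnion_insert, Set.mem_union, not_or]
          exact ⟨hg hv.1, hv.2⟩)
      exact ⟨j, Set.mem_insert_of_mem _ hj, g.comp h, hh⟩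

end IsRadoGraph

/-! ### Parallel copies -/

/-- Two self-embeddings of a graph are parallel if distinct vertices have images which are distinct
and related in the same way, even if they are taken under different embeddings. -/
def Parallel {V : Type u} {R : SimpleGraph V} (f g : R ↪g R) : Prop :=
  ∀ i j, i ≠ j → f i ≠ g j ∧ (R.Adj (f i) (g j) ↔ R.Adj i j)

namespace Parallel

variable {V : Type u} {R : SimpleGraph V} {f g e e' : R ↪g R}

theorem refl (f : R ↪g R) : Parallel f f :=
  fun _ _ h => ⟨f.injective.ne h, f.map_adj_iff⟩

theorem comp (h : Parallel f g) (h' : Parallel e e') : Parallel (f.comp e) (g.comp e') :=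
  fun i j hij => ⟨(h _ _ (h' i j hij).1).1, (h _ _ (h' i j hij).1).2.trans (h' i j hij).2⟩

end Parallel

/-- Inside the Rado graph there are parallel copies in the non-neighbourhood and in the
neighbourhood of any vertex. -/
theorem IsRadoGraph.exists_parallel {V : Type u} {R : SimpleGraph V} (hR : IsRadoGraph R) (v : V) :
    ∃ e : Bool → R ↪g R, (∀ b c, Parallel (e b) (e c)) ∧
      ∀ b i, e b i ≠ v ∧ (R.Adj (e b i) v ↔ b = true) := by
  classical
  obtain ⟨r⟩ := hR.nonempty_equiv
  have : Nonempty V := ⟨v⟩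
  -- Both copies are built together: a term is a pair of vertices, each prescribed relative to `v`
  -- and to both vertices of every earlier term. Nothing is required between the two vertices of one
  -- term, as `Parallel` only concerns distinct arguments.
  obtain ⟨f, hf, hff⟩ := exists_seq_of_forall_extend (β := Bool → V)
    (fun y => ∀ b, y b ≠ v ∧ (R.Adj (y b) v ↔ b = true))
    (fun i j x y => ∀ b c, x b ≠ y c ∧ (R.Adj (x b) (y c) ↔ R.Adj (r i) (r j)))
    fun n f hf hff => by
      let H := insert v ((Finset.range n ×ˢ Finset.univ).image fun a : ℕ × Bool => f a.1 a.2)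
      have hvH : v ∈ H := Finset.mem_insert_self _ _
      have hfH (i : ℕ) (hi : i < n) (b : Bool) : f i b ∈ H := Finset.mem_insert_of_mem
        (Finset.mem_image.2 ⟨(i, b), by simp [hi], rfl⟩)
      let K (c : Bool) := H.filter fun w =>
        (w = v ∧ c = true) ∨ ∃ i < n, ∃ b, w = f i b ∧ R.Adj (r i) (r n)
      have hvK (c : Bool) : v ∈ K c ↔ c = true := by
        simp only [K, Finset.mem_filter, hvH, true_and]
        refine or_iff_left ?_
        rintro ⟨i, hi, b, h, -⟩
        exact (hf i hi b).1 h.symm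
      have hfK (c : Bool) (i : ℕ) (hi : i < n) (b : Bool) :
          f i b ∈ K c ↔ R.Adj (r i) (r n) := by
        simp only [K, Finset.mem_filter, hfH i hi b, true_and]
        refine ⟨?_, fun h => .inr ⟨i, hi, b, rfl, h⟩⟩
        rintro (h | ⟨j, hj, d, hij, h⟩)
        · exact absurd h.1 (hf i hi b).1
        · rcases lt_trichotomy i j with hlt | rfl | hlt
          exacts [absurd hij (hff i j hlt hj b d).1, h, absurd hij.symm (hff j i hlt hi d b).1]
      choose y hy hyK hyH using fun c => hR.2 H (K c) (Finset.filter_subset _ _)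
      have key (c : Bool) (w : V) (hw : w ∈ H) : R.Adj (y c) w ↔ w ∈ K c :=
        ⟨fun h => by_contra fun hc => hyH c w hw hc h, hyK c w⟩
      refine ⟨y, fun c => ⟨fun h => hy c (h ▸ hvH), (key c v hvH).trans (hvK c)⟩,
        fun i hi b c => ⟨fun h => hy c (h ▸ hfH i hi b), ?_⟩⟩
      rw [R.adj_comm, key c _ (hfH i hi b), hfK c i hi b]
  have hpar (b c : Bool) (i j : ℕ) (hij : i ≠ j) :
      f i b ≠ f j c ∧ (R.Adj (f i b) (f j c) ↔ R.Adj (r i) (r j)) := by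
    rcases lt_or_gt_of_ne hij with h | h
    · exact hff i j h b c
    · exact ⟨(hff j i h c b).1.symm, by rw [R.adj_comm, (hff j i h c b).2, R.adj_comm]⟩
  choose e he using fun b => exists_embedding_of_seq r (fun i => f i b)
    fun i j hij => hpar b b i j hij.ne
  refine ⟨e, fun b c a a' haa' => ?_, fun b a => he b a ▸ hf _ b⟩
  rw [he, he]
  simpa using hpar b c _ _ (r.symm.injective.ne haa')

/-! ### Fusion along a decision relation -/

section Fusion

variable {V : Type u} {R : SimpleGraph V}

/-- A relation which behaves like "the copy `range g` forces that `s` is an initial segment of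
the real `x`". -/
structure IsDecision (Dec : (R ↪g R) → List ℕ → Prop) : Prop where
  nil : ∀ g, Dec g []
  comp : ∀ {g : R ↪g R} {s} (h : R ↪g R), Dec g s → Dec (g.comp h) s
  of_prefix : ∀ {g s t}, Dec g t → s <+: t → Dec g s
  unique : ∀ {g s t}, Dec g s → Dec g t → s.length = t.length → s = t
  exists_comp : ∀ (g : R ↪g R) (n : ℕ), ∃ (h : R ↪g R) (s : List ℕ), s.length = n ∧ Dec (g.comp h) s

/-- No simultaneous restriction of `f` and `g` to a copy makes them decide the real differently. -/
def Sim (Dec : (R ↪g R) → List ℕ → Prop) (f g : R ↪g R) : Prop :=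
  ∀ h s t, Dec (f.comp h) s → Dec (g.comp h) t → s.length = t.length → s = t

variable {Dec : (R ↪g R) → List ℕ → Prop}

theorem Sim.comp {f g : R ↪g R} (hfg : Sim Dec f g) (h : R ↪g R) :
    Sim Dec (f.comp h) (g.comp h) :=
  fun k => hfg (h.comp k)

theorem IsDecision.sim_refl (hD : IsDecision Dec) (g : R ↪g R) : Sim Dec g g :=
  fun _ _ _ hs ht => hD.unique hs ht

theorem IsDecision.prefix_of_length_le (hD : IsDecision Dec) {g : R ↪g R} {s t : List ℕ}
    (hs : Dec g s) (ht : Dec g t) (hl : s.length ≤ t.length) : s <+: t := by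
  have : s = t.take s.length :=
    hD.unique hs (hD.of_prefix ht (List.take_prefix _ _)) (by simpa using hl)
  exact this ▸ List.take_prefix _ _

/-- Finitely many dense and hereditary requirements can be met simultaneously. -/
theorem exists_comp_forall_of_finite {ι : Type*} {I : Set ι} (hI : I.Finite)
    (Φ : ι → (R ↪g R) → Prop) (hmono : ∀ (i : ι) (h k : R ↪g R), Φ i h → Φ i (h.comp k))
    (hdense : ∀ (i : ι) (h : R ↪g R), ∃ k, Φ i (h.comp k)) (h : R ↪g R) : ∃ k, ∀ i ∈ I, Φ i (h.comp k) := by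
  induction I, hI using Set.Finite.induction_on with
  | empty => exact ⟨SimpleGraph.Embedding.refl, by simp⟩
  | @insert i I _ _ ih =>
    obtain ⟨k, hk⟩ := ih
    obtain ⟨l, hl⟩ := hdense i (h.comp k)
    refine ⟨k.comp l, fun j hj => ?_⟩
    rcases hj with rfl | hj
    exacts [hl, hmono j _ l (hk j hj)]

/-- Finitely many embeddings can be restricted to a common copy so that all of them decide initial
segments of the same length, and those which can be made to decide differently do so. -/
theorem IsDecision.exists_uniform (hD : IsDecision Dec) {G : Set (R ↪g R)} (hG : G.Finite)
    (n : ℕ) : ∃ (h : R ↪g R) (l : ℕ) (u : (R ↪g R) → List ℕ), n ≤ l ∧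
      (∀ g ∈ G, (u g).length = l ∧ Dec (g.comp h) (u g)) ∧
      ∀ g ∈ G, ∀ g' ∈ G, u g = u g' → Sim Dec (g.comp h) (g'.comp h) := by
  -- A pair of embeddings is either inseparable from now on or already separated at length `l`.
  -- Failure of the first alternative provides a restriction with the second, so the requirement is
  -- dense.
  let Ψ (l : ℕ) (a : (R ↪g R) × (R ↪g R)) (h : R ↪g R) : Prop :=
    Sim Dec (a.1.comp h) (a.2.comp h) ∨
      ∃ s t, s.length = l ∧ t.length = l ∧ s ≠ t ∧ Dec (a.1.comp h) s ∧ Dec (a.2.comp h) t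
  have hΨ (l : ℕ) (a : (R ↪g R) × (R ↪g R)) (h k : R ↪g R) : Ψ l a h → Ψ l a (h.comp k) := by
    rintro (H | ⟨s, t, hs, ht, hst, ds, dt⟩)
    exacts [.inl (H.comp k), .inr ⟨s, t, hs, ht, hst, hD.comp k ds, hD.comp k dt⟩]
  obtain ⟨h₁, hh₁⟩ := exists_comp_forall_of_finite (hG.prod hG) (fun a h => ∃ l, Ψ l a h)
    (fun a h k ⟨l, H⟩ => ⟨l, hΨ l a h k H⟩) (fun a h => by
      by_cases H : Sim Dec (a.1.comp h) (a.2.comp h)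
      · exact ⟨SimpleGraph.Embedding.refl, 0, .inl (H.comp _)⟩
      · simp only [Sim, not_forall] at H
        obtain ⟨k, s, t, ds, dt, hl, hst⟩ := H
        exact ⟨k, t.length, .inr ⟨s, t, hl, rfl, hst, ds, dt⟩⟩) SimpleGraph.Embedding.refl
  choose! L hL using hh₁
  -- A common bound for the finitely many separating lengths: values of length at least `M` show
  -- every separation.
  obtain ⟨M, hM⟩ := ((hG.prod hG).image L).bddAbove
  obtain ⟨h₂, hh₂⟩ := exists_comp_forall_of_finite hG
    (fun g h => ∃ s : List ℕ, s.length = max n M ∧ Dec (g.comp h) s)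
    (fun g h k ⟨s, hs, ds⟩ => ⟨s, hs, hD.comp k ds⟩) (fun g h => hD.exists_comp (g.comp h) _)
    (SimpleGraph.Embedding.refl.comp h₁)
  choose! u hu hdu using hh₂
  refine ⟨_, max n M, u, le_max_left _ _, fun g hg => ⟨hu g hg, hdu g hg⟩,
    fun g hg g' hg' huu => ?_⟩
  rcases hΨ _ (g, g') _ h₂ (hL (g, g') ⟨hg, hg'⟩) with H | ⟨s, t, hs, ht, hst, ds, dt⟩
  · exact H
  · have hLM : L (g, g') ≤ max n M :=
      (hM (Set.mem_image_of_mem L (Set.mk_mem_prod hg hg'))).trans (le_max_right _ _)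
    have h1 := hD.prefix_of_length_le ds (hdu g hg) (by rw [hs, hu g hg]; exact hLM)
    have h2 := hD.prefix_of_length_le dt (hdu g' hg') (by rw [ht, hu g' hg']; exact hLM)
    rw [← huu] at h2
    exact absurd ((List.prefix_of_prefix_length_le h1 h2 (by omega)).eq_of_length (by omega)) hst

/-- A stage of the fusion: finitely many pairwise parallel embeddings `emb σ`, which decide initial
segments `val σ` of the same length, such that embeddings with the same value are similar. -/
structure FusionStage (Dec : (R ↪g R) → List ℕ → Prop) where
  emb : (ℕ → Bool) → R ↪g R
  len : ℕ
  val : (ℕ → Bool) → List ℕ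
  finite : (Set.range emb).Finite
  parallel : ∀ σ τ, Parallel (emb σ) (emb τ)
  length_val : ∀ σ, (val σ).length = len
  dec : ∀ σ, Dec (emb σ) (val σ)
  sim : ∀ σ τ, val σ = val τ → Sim Dec (emb σ) (emb τ)

/-- The first stage of the fusion. -/
def IsDecision.initialStage (hD : IsDecision Dec) : FusionStage Dec where
  emb _ := SimpleGraph.Embedding.refl
  len := 0
  val _ := []
  finite := Set.finite_range_const
  parallel _ _ := Parallel.refl _
  length_val _ := rfl
  dec _ := hD.nil _
  sim _ _ _ := hD.sim_refl _

/-- Bit `n` selects the side of `v`, and then one `h` makes all the resulting embeddings uniform.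
Using the same `h` for every `σ` preserves parallelism and allows it to be absorbed into `e`, so
that two embeddings with the same bit are composed with the same embedding. -/
theorem FusionStage.exists_succ (hR : IsRadoGraph R) (hD : IsDecision Dec) (v : V) (n : ℕ)
    (S : FusionStage Dec) : ∃ (S' : FusionStage Dec) (e : Bool → R ↪g R),
      (∀ b i, e b i ≠ v ∧ (R.Adj (e b i) v ↔ b = true)) ∧
      (∀ σ, S'.emb σ = (S.emb σ).comp (e (σ n))) ∧ S.len < S'.len := by
  obtain ⟨e, he, hev⟩ := hR.exists_parallel v
  have hfin : (Set.range fun σ => (S.emb σ).comp (e (σ n))).Finite := by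
    refine (S.finite.image2 (fun g b => g.comp (e b)) (Set.finite_univ (α := Bool))).subset ?_
    rintro _ ⟨σ, rfl⟩
    exact ⟨_, ⟨σ, rfl⟩, σ n, Set.mem_univ _, rfl⟩
  obtain ⟨h, l, u, hl, hu, hsim⟩ := hD.exists_uniform hfin (S.len + 1)
  refine ⟨{ emb := fun σ => ((S.emb σ).comp (e (σ n))).comp h
            len := l
            val := fun σ => u ((S.emb σ).comp (e (σ n)))
            finite := ?_
            parallel := fun σ τ => ((S.parallel σ τ).comp (he _ _)).comp (Parallel.refl h)
            length_val := fun σ => (hu _ ⟨σ, rfl⟩).1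
            dec := fun σ => (hu _ ⟨σ, rfl⟩).2
            sim := fun σ τ => hsim _ ⟨σ, rfl⟩ _ ⟨τ, rfl⟩ },
    fun b => (e b).comp h, fun b i => hev b (h i), fun σ => rfl, hl⟩
  refine (hfin.image fun g => g.comp h).subset ?_
  rintro _ ⟨σ, rfl⟩
  exact ⟨_, ⟨σ, rfl⟩, rfl⟩

/-- Below every copy of the Rado graph there is a copy which forces the real to be a branch of a
binary tree. -/
theorem IsDecision.exists_fusion (hR : IsRadoGraph R) (hD : IsDecision Dec) :
    ∃ (f : R ↪g R) (T : Descriptive.tree ℕ), Ground.IsBinary T ∧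
      ∀ n, ∃ G : Set (R ↪g R), G.Finite ∧ (Set.range f \ ⋃ g ∈ G, Set.range g).Finite ∧
        ∀ g ∈ G, ∃ s ∈ T, s.length = n ∧ Dec g s := by
  classical
  obtain ⟨r⟩ := hR.nonempty_equiv
  -- Any fixed vertex will do: the vertices of the new copy are its images at the successive stages.
  let v : V := r 0
  choose next e hev hemb hlen using FusionStage.exists_succ hR hD v
  obtain ⟨S, hS0, hS⟩ : ∃ S : ℕ → FusionStage Dec,
      S 0 = hD.initialStage ∧ ∀ n, S (n + 1) = next n (S n) :=
    ⟨fun n => Nat.rec hD.initialStage next n, rfl, fun n => rfl⟩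
  have hSe (n σ) : (S (n + 1)).emb σ = ((S n).emb σ).comp (e n (S n) (σ n)) := by
    rw [hS, hemb]
  have hSl : StrictMono fun n => (S n).len := strictMono_nat_of_lt_succ fun n => hS n ▸ hlen n (S n)
  have hfac (n m : ℕ) (hnm : n ≤ m) (σ) : ∃ k : R ↪g R, (S m).emb σ = ((S n).emb σ).comp k := by
    induction m, hnm using Nat.le_induction with
    | base => exact ⟨SimpleGraph.Embedding.refl, rfl⟩
    | succ m _ ih =>
      obtain ⟨k, hk⟩ := ih
      exact ⟨k.comp (e m (S m) (σ m)), by rw [hSe, hk]; rfl⟩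
  have hpre (n m : ℕ) (hnm : n ≤ m) (σ) : (S n).val σ <+: (S m).val σ := by
    obtain ⟨k, hk⟩ := hfac n m hnm σ
    refine hD.prefix_of_length_le (hk ▸ hD.comp k ((S n).dec σ)) ((S m).dec σ) ?_
    rw [(S n).length_val, (S m).length_val]
    exact hSl.monotone hnm
  -- the vertices of the new copy
  let target (n : ℕ) : ℕ → Bool := fun i => decide (R.Adj (r i) (r n))
  -- Stage `n` depends only on the bits below `n`, which record the adjacency of `r n` to the
  -- earlier vertices.
  let c (n : ℕ) : V := (S n).emb (target n) v
  have hc (m n : ℕ) (hmn : m < n) : c m ≠ c n ∧ (R.Adj (c m) (c n) ↔ R.Adj (r m) (r n)) := by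
    -- Seen from stage `m`, `c n` is the image of a point on the side of `v` prescribed by bit `m`
    -- of `target n`. The indices `target m` and `target n` may give different embeddings, hence the
    -- need for parallelism.
    obtain ⟨k, hk⟩ := hfac (m + 1) n hmn (target n)
    have hw := hev m (S m) (target n m) (k v)
    have hcn : c n = (S m).emb (target n) (e m (S m) (target n m) (k v)) := by
      change (S n).emb (target n) v = _
      rw [hk, hSe]; rfl
    have := (S m).parallel (target m) (target n) v _ hw.1.symm
    rw [hcn]
    refine ⟨this.1, this.2.trans ?_⟩
    rw [R.adj_comm, hw.2]
    simp [target]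
  obtain ⟨f, hf⟩ := exists_embedding_of_seq r c hc
  -- the tree of possible values
  let T : Descriptive.tree ℕ := ⟨{s | ∃ n σ, s <+: (S n).val σ},
    fun s a ⟨n, σ, h⟩ => ⟨n, σ, (List.prefix_append _ _).trans h⟩⟩
  refine ⟨f, T, fun s hs => ?_, fun n => ⟨Set.range (S n).emb, (S n).finite, ?_, ?_⟩⟩
  -- Let `n + 1` be the first stage whose values are longer than `s`; it is not `0`, where values
  -- are empty. Then every successor of `s` lies on a value of stage `n + 1` whose predecessor at
  -- stage `n` is a prefix of `s`.
  · have hex : ∃ N, s.length < (S N).len :=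
      ⟨s.length + 1, (Nat.lt_succ_self _).trans_le (hSl.le_apply)⟩
    obtain ⟨n, hn⟩ : ∃ n, Nat.find hex = n + 1 := Nat.exists_eq_succ_of_ne_zero fun h0 => by
      have := Nat.find_spec hex
      rw [h0, hS0] at this
      exact absurd this (Nat.not_lt_zero _)
    have hlt : s.length < (S (n + 1)).len := hn ▸ Nat.find_spec hex
    have hle : (S n).len ≤ s.length := not_lt.1 (Nat.find_min hex (by omega))
    have key : ∀ t ∈ {t : List ℕ | t ∈ T ∧ ∃ m : ℕ, t = s ++ [m]}, ∃ τ : ℕ → Bool,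
        t <+: (S (n + 1)).val τ ∧ (S n).val τ <+: s ∧ t.length = s.length + 1 := by
      rintro t ⟨⟨k, τ, hk⟩, m, rfl⟩
      have hnk : n + 1 ≤ k := by
        by_contra hcon
        have h1 := hk.length_le
        rw [(S k).length_val] at h1
        have h2 : (S k).len ≤ (S n).len := hSl.monotone (by omega)
        simp at h1
        omega
      have h1 : s ++ [m] <+: (S (n + 1)).val τ :=
        List.prefix_of_prefix_length_le hk (hpre _ _ hnk τ) (by
          rw [(S _).length_val, List.length_append]; exact hlt)
      exact ⟨τ, h1, List.prefix_of_prefix_length_le (hpre n (n + 1) (by omega) τ)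
        ((List.prefix_append _ _).trans h1) (by rwa [(S _).length_val]), by simp⟩
    choose! τ h1 h2 h3 using key
    -- A successor is determined by bit `n` of its index: the values at stage `n` are equal-length
    -- prefixes of `s`, hence equal, so the embeddings are similar. With the same bit they remain
    -- similar at stage `n + 1` and decide the same value.
    refine (Set.encard_le_encard_of_injOn (t := (Set.univ : Set Bool)) (f := fun t => τ t n)
      (fun _ _ => Set.mem_univ _) fun t ht t' ht' htt' => ?_).trans ?_
    · have hval : (S n).val (τ t) = (S n).val (τ t') :=
        (List.prefix_of_prefix_length_le (h2 t ht) (h2 t' ht') (by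
          rw [(S n).length_val, (S n).length_val])).eq_of_length (by
          rw [(S n).length_val, (S n).length_val])
      have hsim : Sim Dec ((S (n + 1)).emb (τ t)) ((S (n + 1)).emb (τ t')) := by
        rw [hSe, hSe, show τ t n = τ t' n from htt']
        exact ((S n).sim _ _ hval).comp _
      have hval' : (S (n + 1)).val (τ t) = (S (n + 1)).val (τ t') :=
        hsim SimpleGraph.Embedding.refl _ _ ((S _).dec _) ((S _).dec _) (by
          rw [(S _).length_val, (S _).length_val])
      exact (List.prefix_of_prefix_length_le (h1 t ht) (hval' ▸ h1 t' ht') (by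
        rw [h3 t ht, h3 t' ht'])).eq_of_length (by rw [h3 t ht, h3 t' ht'])
    · rw [Set.encard_univ, ENat.card_eq_coe_fintype_card]; rfl
  -- From index `n` on, every vertex of the new copy comes from an embedding that factors through
  -- stage `n`, so only the first `n` vertices can be uncovered.
  · refine ((Set.finite_lt_nat n).image c).subset ?_
    rintro _ ⟨⟨a, rfl⟩, ha⟩
    refine ⟨r.symm a, by_contra fun hcon => ha ?_, (hf a).symm⟩
    obtain ⟨k, hk⟩ := hfac n (r.symm a) (not_lt.1 hcon) (target (r.symm a))
    refine Set.mem_biUnion ⟨target (r.symm a), rfl⟩ ⟨k v, ?_⟩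
    rw [hf]
    change _ = (S (r.symm a)).emb _ v
    rw [hk]; rfl
  · rintro _ ⟨σ, rfl⟩
    refine ⟨((S n).val σ).take n, ⟨n, σ, List.take_prefix _ _⟩, ?_,
      hD.of_prefix ((S n).dec σ) (List.take_prefix _ _)⟩
    rw [List.length_take, (S n).length_val]
    exact min_eq_left hSl.le_apply

end Fusion

/-! ### From embeddings back to forcing conditions -/

theorem SimpleGraph.Embedding.exists_comp_eq {V : Type u} {R : SimpleGraph V} {f g : R ↪g R}
    (h : Set.range g ⊆ Set.range f) : ∃ k : R ↪g R, f.comp k = g := by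
  choose k hk using fun a => h ⟨a, rfl⟩
  refine ⟨⟨⟨k, fun a b hab => g.injective ?_⟩, fun {a b} => ?_⟩, ?_⟩
  · rw [← hk, hab, hk]
  · change R.Adj (k a) (k b) ↔ R.Adj a b
    rw [← f.map_adj_iff, hk, hk, g.map_adj_iff]
  · ext a
    exact hk a

/-- The copy of a graph given by a self-embedding. -/
def Copies.of {V : Type u} {R : SimpleGraph V} (f : R ↪g R) : Copies R := ⟨Set.range f, f, rfl⟩

theorem Copies.of_comp_le {V : Type u} {R : SimpleGraph V} (f g : R ↪g R) :
    Copies.of (f.comp g) ≤ Copies.of f := by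
  rintro _ ⟨a, rfl⟩
  exact ⟨g a, rfl⟩

theorem Copies.exists_of_comp_eq {V : Type u} {R : SimpleGraph V} {f : R ↪g R} {q : Copies R}
    (h : q ≤ Copies.of f) : ∃ g : R ↪g R, Copies.of (f.comp g) = q := by
  obtain ⟨_, g, rfl⟩ := q
  obtain ⟨k, rfl⟩ := SimpleGraph.Embedding.exists_comp_eq (f := f) (g := g) h
  exact ⟨k, rfl⟩

open Forcing in
-- Every condition below the copy given by `f` is the range of some `f.comp h`, so density below
-- that copy turns into precomposition.
theorem Forcing.IsReal.isDecision {V : Type u} {R : SimpleGraph V} {x : PName (Copies R)}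
    {f : R ↪g R} (hx : IsReal x (Copies.of f)) :
    IsDecision fun (g : R ↪g R) s => Decides x (Copies.of (f.comp g)) s where
  nil _ := fun i hi => absurd hi (Nat.not_lt_zero i)
  comp h H := H.mono (Copies.of_comp_le (f.comp _) h)
  of_prefix H hs := H.of_prefix hs
  unique := hx.decides_unique (Copies.of_comp_le _ _)
  exists_comp g n := by
    obtain ⟨r, hr, s, hs, H⟩ := hx.exists_decides (Copies.of_comp_le f g) n
    obtain ⟨h, rfl⟩ := Copies.exists_of_comp_eq hr
    exact ⟨h, s, hs, H⟩

theorem theorem3p3 {V : Type u} (R : SimpleGraph V) (hR : IsRadoGraph R) :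
    TwoLocalization (Copies R) := by
  intro p x q hq hx q' hq'
  obtain ⟨f₀, rfl⟩ : ∃ f : R ↪g R, Copies.of f = q' := by
    obtain ⟨_, f, rfl⟩ := q'
    exact ⟨f, rfl⟩
  have mono : Forcing.IsReal x (Copies.of f₀) :=
    ⟨fun z r hr => hx.1 z r (hr.trans hq'), fun z r hr => hx.2 z r (hr.trans hq')⟩
  obtain ⟨f, T, hT, H⟩ := mono.isDecision.exists_fusion hR
  have hle := Copies.of_comp_le f₀ f
  have mono' : Forcing.IsReal x (Copies.of (f₀.comp f)) :=
    ⟨fun z r hr => mono.1 z r (hr.trans hle), fun z r hr => mono.2 z r (hr.trans hle)⟩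
  refine ⟨Copies.of (f₀.comp f), hle, mono'.exIn_binaryTrees T hT fun r hr n => ?_⟩
  obtain ⟨h, rfl⟩ := Copies.exists_of_comp_eq hr
  obtain ⟨G, hG, hfin, hdec⟩ := H n
  -- The ranges of the embeddings in `G` cover all but finitely many vertices of the given smaller
  -- copy, so a subcopy lies inside one of them and inherits its decision.
  obtain ⟨g, hg, k, hk⟩ := hR.exists_embedding_of_diff_finite hG (fun g => Set.range g) (f.comp h)
    (hfin.subset (Set.sdiff_subset_sdiff_left (Copies.of_comp_le f h)))
  obtain ⟨s, hs, hsn, hd⟩ := hdec g hg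
  obtain ⟨k', hk'⟩ := SimpleGraph.Embedding.exists_comp_eq hk
  refine ⟨Copies.of (f₀.comp ((f.comp h).comp k)), Copies.of_comp_le ((f₀.comp f).comp h) k,
    s, hs, hsn, hd.mono ?_⟩
  rw [← hk']
  exact Copies.of_comp_le (f₀.comp g) k'
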